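/- Let $\mathsf A=\{(0,0),(1,0),(0,1)\}\subset\mathbb Z^2$, and let $\Omega_{\mathsf A}\subset \mathsf A^{\mathbb Z^2}$ be the set of all $\omega=(\omega_{\mathbf n})_{\mathbf n\in\mathbb Z^2}$ with values in $\mathsf A$ for which the map $\mathbf n\mapsto \mathbf n+\omega_{\mathbf n}$ is a permutation of $\mathbb Z^2$, with the topology induced by the product topology on $\mathsf A^{\mathbb Z^2}$ ($\mathsf A$ discrete). Let $\mathbb Z^2$ act on $\Omega_{\mathsf A}$ by the shift $(\sigma^{\mathbf m}\omega)_{\mathbf n}=\omega_{\mathbf n+\mathbf m}$. For a subgroup $\Gamma\subset\mathbb Z^2$ put $\mathrm{Fix}_\Gamma(\Omega_{\mathsf A})=\{\omega\in\Omega_{\mathsf A}:\sigma^{\mathbf n}\omega=\omega\text{ for every }\mathbf n\in\Gamma\}$, and call $\omega\in\Omega_{\mathsf A}$ periodic if $\omega\in\mathrm{Fix}_\Gamma(\Omega_{\mathsf A})$ for some finite-index subgroup $\Gamma\subset\mathbb Z^2$. Let $$h(\Omega_{\mathsf A})=\lim_{n\to\infty}\frac1{n^2}\log\bigl|\{\omega|_{\{0,\dots,n-1\}^2}:\omega\in\Omega_{\mathsf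 A}\}\bigr|$$ be the topological entropy of $\Omega_{\mathsf A}$ (this limit exists). Then the set of periodic points is dense in $\Omega_{\mathsf A}$. Furthermore, $$h(\Omega_{\mathsf A})=\lim_{K\to\infty}\frac{1}{|\mathbb Z^2/\Delta_K|}\log\bigl|\mathrm{Fix}_{\Delta_K}(\Omega_{\mathsf A})\bigr|,$$ where $\Delta_K=\{2k(K^3+2K)\cdot(1,0)+2lK\cdot(1,1):k,l\in\mathbb Z\}\subset\mathbb Z^2$ for every $K\ge1$; here $\mathbb Z^2/\Delta_K$ and $\mathrm{Fix}_{\Delta_K}(\Omega_{\mathsf A})$ are finite for every $K\ge 1$. -/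

import Mathlib

open Filter Topology

namespace RestrictedMovement

/-- The set `Π_A` of all permutations `π` of `ℤ²` such that `π n - n ∈ A` for every `n ∈ ℤ²`. -/
def restrictedPerms (A : Finset (ℤ × ℤ)) : Set (Equiv.Perm (ℤ × ℤ)) :=
  {π | ∀ n : ℤ × ℤ, π n - n ∈ A}

/-- The configuration `ω^(π) ∈ A^(ℤ²)`, `ω^(π)_n = π n - n`, of a permutation `π ∈ Π_A`. -/
def displacement (A : Finset (ℤ × ℤ)) (π : restrictedPerms A) : ℤ × ℤ → A :=
  fun n => ⟨π.1 n - n, π.2 n⟩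

/-- The space `Ω_A = {ω^(π) : π ∈ Π_A}`, a subset of the full shift `A^(ℤ²)`; the latter carries
the product topology, `A` being discrete. -/
def Omega (A : Finset (ℤ × ℤ)) : Set (ℤ × ℤ → A) :=
  Set.range (displacement A)

/-- `Fix_Γ(X)`: the points `ω ∈ X` with `σ^n ω = ω` for every `n ∈ Γ`, where
`(σ^n ω)_m = ω_(n + m)` is the shift action of `ℤ²`. -/
def fixedBySubgroup {S : Type*} (Γ : AddSubgroup (ℤ × ℤ)) (X : Set (ℤ × ℤ → S)) :
    Set (ℤ × ℤ → S) :=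
  {ω | ω ∈ X ∧ ∀ n ∈ Γ, SymbolicDynamics.FullShift.shift n ω = ω}

/-- The periodic points of `X`: those fixed by some finite-index subgroup of `ℤ²`. -/
def periodicPoints {S : Type*} (X : Set (ℤ × ℤ → S)) : Set (ℤ × ℤ → S) :=
  {ω | ∃ Γ : AddSubgroup (ℤ × ℤ), Γ.FiniteIndex ∧ ω ∈ fixedBySubgroup Γ X}

/-- The projection of `X` onto the coordinates in `F`: all patterns of shape `F` that occur in
elements of `X`. -/
def patterns {S : Type*} (X : Set (ℤ × ℤ → S)) (F : Finset (ℤ × ℤ)) : Set (F → S) :=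
  (fun ω : ℤ × ℤ → S => fun n : F => ω n) '' X

/-- The square box `{0, …, n - 1}²` in `ℤ²`. -/
noncomputable def box (n : ℕ) : Finset (ℤ × ℤ) :=
  Finset.Ico (0 : ℤ) n ×ˢ Finset.Ico (0 : ℤ) n

/-- The exponential growth rate `n⁻² log |patterns of shape {0, …, n - 1}²|`. -/
noncomputable def patternRate {S : Type*} (X : Set (ℤ × ℤ → S)) (n : ℕ) : ℝ :=
  Real.log ((patterns X (box n)).ncard : ℝ) / (n : ℝ) ^ 2

/-- The topological entropy of a `ℤ²`-subshift `X` over a finite alphabet. -/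
noncomputable def entropy {S : Type*} (X : Set (ℤ × ℤ → S)) : ℝ :=
  limsup (patternRate X) atTop

/-- The subgroup `Δ_K = {2k(K³ + 2K)·(1,0) + 2lK·(1,1) : k, l ∈ ℤ}` of `ℤ²`. -/
def Delta (K : ℕ) : AddSubgroup (ℤ × ℤ) where
  carrier := {v | ∃ k l : ℤ,
    v = (2 * k * ((K : ℤ) ^ 3 + 2 * K)) • ((1, 0) : ℤ × ℤ) + (2 * l * (K : ℤ)) • ((1, 1) : ℤ × ℤ)}
  zero_mem' := ⟨0, 0, by simp⟩
  add_mem' := by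
    rintro _ _ ⟨k, l, rfl⟩ ⟨k', l', rfl⟩
    refine ⟨k + k', l + l', ?_⟩
    ext <;> simp
    all_goals ring
  neg_mem' := by
    rintro _ ⟨k, l, rfl⟩
    refine ⟨-k, -l, ?_⟩
    ext <;> simp
    ring

/-- The set `A = {(0,0), (1,0), (0,1)}` of allowed movements. -/
def cornerSet : Finset (ℤ × ℤ) := {(0, 0), (1, 0), (0, 1)}

end RestrictedMovement

/-! Elements of `Omega cornerSet` are perfect matchings of the honeycomb lattice: the black vertex
of a site is its source, the white vertex its target, and the three movements are the three edge
directions (`config_mem_Omega`, `exists_isMatching`). Cut the lattice into triangles of side `L` and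
fold the plane onto one of them by reflecting in the sides. The three-colouring of the corners makes
the folding consistent. An edge crossing a side joins a vertex to its mirror image, so both ends
fold to the same boundary vertex (`fold_step_of_eq`). Hence triangle patterns that agree on which
boundary edges cross can be placed independently in all triangles (`isMatching_glue`).

Density: take a large triangle around the origin, keep the pattern seen there, and reflect it over
the whole plane.

Entropy, lower bound: let `P` be the number of triangle patterns. A cell of side `L` consists of two
triangles, so `h ≤ 2 log P / L²`. A side has `L` vertices, so by pigeonhole at least `P / 2^(3L)`
patterns share their boundary data (`exists_common_boundary`). Placing these freely modulo `Δ_K`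
gives at least `h - 6 log 2 / L` for the periodic rate. This needs `Δ_K` to respect the triangles
and their colouring, which holds with `L = 2K`, or `L = 2K/3` when `3 ∣ K`.

Upper bound: `K² + 2` boxes of side `2K` form a fundamental domain of `Δ_K`, so the periodic rate is
at most the pattern rate of such a box. -/

namespace RestrictedMovement

/-! ### Honeycomb matchings and reflected triangles -/

/-- Sum of the three coordinates. The vertices of the honeycomb lattice are the `v : ZMod 3 → ℤ`
with `total v = -1` (black) or `total v = -2` (white). -/
def total (v : ZMod 3 → ℤ) : ℤ := v 0 + v 1 + v 2

/-- Increase the `i`-th coordinate by one. -/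
def step (v : ZMod 3 → ℤ) (i : ZMod 3) : ZMod 3 → ℤ := fun j => if j = i then v j + 1 else v j

/-- A perfect matching of the honeycomb lattice: every vertex chooses the direction of its edge,
and the two ends of each edge agree. -/
def IsMatching (τ : (ZMod 3 → ℤ) → ZMod 3) : Prop :=
  ∀ v, total v = -2 → ∀ i, τ v = i ↔ τ (step v i) = i

/-- The triangle of side `L` (in cells) containing a vertex. -/
def coarse (L : ℤ) (v : ZMod 3 → ℤ) : ZMod 3 → ℤ := fun j => v j / L

/-- The direction of a triangle `F` in the reference triangle: the colour of the corner opposite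
to a side, in the three-colouring of the triangular lattice. -/
def label (F : ZMod 3 → ℤ) : ZMod 3 ≃ ZMod 3 where
  -- Crossing from a downward triangle through side `i` changes `F 0 - F 1` by `i + 1` modulo 3. The
  -- signs and the shift by one make both triangles give their common side the same colour.
  toFun i := if total F = -1 then ((F 0 - F 1 : ℤ) : ZMod 3) + i + 1
    else ((F 0 - F 1 : ℤ) : ZMod 3) - i - 1
  invFun c := if total F = -1 then c - ((F 0 - F 1 : ℤ) : ZMod 3) - 1
    else ((F 0 - F 1 : ℤ) : ZMod 3) - c - 1
  left_inv i := by split_ifs <;> ring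
  right_inv c := by split_ifs <;> ring

/-- The image of a vertex in the reference triangle under reflections in the sides of triangles. -/
def fold (L : ℤ) (v : ZMod 3 → ℤ) : ZMod 3 → ℤ := fun c =>
  if total (coarse L v) = -1 then v ((label (coarse L v)).symm c) % L
  else L - 1 - v ((label (coarse L v)).symm c) % L

/-- The vertex of the triangle `F` with a given image in the reference triangle. -/
def unfold (L : ℤ) (F R : ZMod 3 → ℤ) : ZMod 3 → ℤ := fun j =>
  L * F j + if total F = -1 then R (label F j) else L - 1 - R (label F j)

/-- The reference triangle. -/
def InTriangle (L : ℤ) (R : ZMod 3 → ℤ) : Prop :=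
  (∀ c, 0 ≤ R c) ∧ (total R = L - 1 ∨ total R = L - 2)

/-- Restrictions of matchings to the reference triangle, extended by zero. -/
def IsTrianglePattern (L : ℤ) (p : (ZMod 3 → ℤ) → ZMod 3) : Prop :=
  (∀ R, (∀ c, 0 ≤ R c) → total R = L - 2 → ∀ c, p R = c ↔ p (step R c) = c) ∧
    ∀ R, ¬ InTriangle L R → p R = 0

/-- The configuration which shows the pattern `f F` in the triangle `F`. -/
def glue (L : ℤ) (f : (ZMod 3 → ℤ) → (ZMod 3 → ℤ) → ZMod 3) : (ZMod 3 → ℤ) → ZMod 3 := fun v =>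
  (label (coarse L v)).symm (f (coarse L v) (fold L v))

open Classical in
/-- The pattern which a configuration shows in the triangle `F`. -/
noncomputable def extract (L : ℤ) (τ : (ZMod 3 → ℤ) → ZMod 3) (F : ZMod 3 → ℤ) :
    (ZMod 3 → ℤ) → ZMod 3 := fun R =>
  if InTriangle L R then label F (τ (unfold L F R)) else 0

/-! ### Folding onto the reference triangle and gluing -/

theorem zmod_three_cases (c : ZMod 3) : c = 0 ∨ c = 1 ∨ c = 2 := by
  revert c; decide

theorem zmod_three_eq_zero : (3 : ZMod 3) = 0 := rfl

theorem forall_zmod_three {P : ZMod 3 → Prop} : (∀ c, P c) ↔ P 0 ∧ P 1 ∧ P 2 :=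
  ⟨fun h => ⟨h 0, h 1, h 2⟩, fun h c => by
    rcases zmod_three_cases c with rfl | rfl | rfl
    exacts [h.1, h.2.1, h.2.2]⟩

theorem total_comp_equiv (e : ZMod 3 ≃ ZMod 3) (v : ZMod 3 → ℤ) :
    total (fun j => v (e j)) = total v := by
  have h : ∀ w : ZMod 3 → ℤ, total w = ∑ j, w j := fun w => by
    rw [total]; exact (Fin.sum_univ_three w).symm
  rw [h, h]
  exact Equiv.sum_comp e v

theorem total_step (v : ZMod 3 → ℤ) (i : ZMod 3) : total (step v i) = total v + 1 := by
  have h01 : (0 : ZMod 3) ≠ 1 := by decide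
  have h02 : (0 : ZMod 3) ≠ 2 := by decide
  have h12 : (1 : ZMod 3) ≠ 2 := by decide
  rcases zmod_three_cases i with rfl | rfl | rfl <;>
    simp [total, step, h01, h02, h12, h01.symm, h02.symm, h12.symm] <;> ring

theorem total_eq_coarse (L : ℤ) (v : ZMod 3 → ℤ) :
    total v = L * total (coarse L v) + total (fun j => v j % L) := by
  simp only [total, coarse]
  linarith [Int.mul_ediv_add_emod (v 0) L, Int.mul_ediv_add_emod (v 1) L,
    Int.mul_ediv_add_emod (v 2) L]

/-- The three residues add up to between `0` and `3L - 3`, which leaves only the two kinds of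
triangles. -/
theorem total_coarse {L : ℤ} (hL : 0 < L) {v : ZMod 3 → ℤ} (hv : total v = -1 ∨ total v = -2) :
    total (coarse L v) = -1 ∨ total (coarse L v) = -2 := by
  have h := total_eq_coarse L v
  have h1 := fun j => Int.emod_nonneg (v j) hL.ne'
  have h2 := fun j => Int.emod_lt_of_pos (v j) hL
  have h3 : 0 ≤ total (fun j => v j % L) := by
    simp only [total]; linarith [h1 0, h1 1, h1 2]
  have h4 : total (fun j => v j % L) ≤ 3 * L - 3 := by
    simp only [total]; linarith [h2 0, h2 1, h2 2]
  have h5 : total (coarse L v) < 0 := by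
    by_contra hc
    have : 0 ≤ L * total (coarse L v) := mul_nonneg hL.le (by omega)
    omega
  have h6 : -3 < total (coarse L v) := by
    by_contra hc
    have : L * total (coarse L v) ≤ L * (-3) := mul_le_mul_of_nonneg_left (by omega) hL.le
    omega
  omega

theorem total_fold_up {L : ℤ} {v : ZMod 3 → ℤ} (hF : total (coarse L v) = -1) :
    total (fold L v) = total v + L := by
  have h := total_eq_coarse L v
  have h1 := total_comp_equiv (label (coarse L v)).symm (fun j => v j % L)
  have h2 : fold L v = fun c => v ((label (coarse L v)).symm c) % L := by
    funext c; simp [fold, hF]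
  rw [h2, h1, h, hF]; ring

/-- In contrast to upward triangles, the folding exchanges black and white here: white vertices land
on total `L - 1`, black ones on `L - 2`. -/
theorem total_fold_down {L : ℤ} {v : ZMod 3 → ℤ} (hF : total (coarse L v) = -2) :
    total (fold L v) = L - 3 - total v := by
  have h := total_eq_coarse L v
  have h1 := total_comp_equiv (label (coarse L v)).symm (fun j => v j % L)
  have h2 : fold L v = fun c => L - 1 - v ((label (coarse L v)).symm c) % L := by
    funext c; simp [fold, hF]
  have h3 : total (fold L v) = 3 * (L - 1) - total (fun j => v j % L) := by
    rw [← h1, h2]; simp only [total]; ring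
  rw [hF] at h
  linarith

theorem fold_nonneg {L : ℤ} (hL : 0 < L) (v : ZMod 3 → ℤ) (c : ZMod 3) : 0 ≤ fold L v c := by
  have h1 := fun j => Int.emod_nonneg (v j) hL.ne'
  have h2 := fun j => Int.emod_lt_of_pos (v j) hL
  unfold fold
  split_ifs
  · exact h1 _
  · linarith [h2 ((label (coarse L v)).symm c)]

theorem inTriangle_fold {L : ℤ} (hL : 0 < L) {v : ZMod 3 → ℤ}
    (hv : total v = -1 ∨ total v = -2) : InTriangle L (fold L v) := by
  refine ⟨fold_nonneg hL v, ?_⟩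
  rcases total_coarse hL hv with h | h
  · have := total_fold_up h; omega
  · have := total_fold_down h; omega

theorem coarse_step_of_lt {L : ℤ} (hL : 0 < L) {v : ZMod 3 → ℤ} {i : ZMod 3}
    (hi : v i % L < L - 1) : coarse L (step v i) = coarse L v ∧
      ∀ j, step v i j % L = v j % L + if j = i then 1 else 0 := by
  have key : (v i + 1) / L = v i / L ∧ (v i + 1) % L = v i % L + 1 := by
    refine (Int.ediv_emod_unique hL).2 ⟨?_, ?_, ?_⟩
    · linarith [Int.mul_ediv_add_emod (v i) L]
    · linarith [Int.emod_nonneg (v i) hL.ne']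
    · linarith
  constructor
  · funext j
    by_cases hj : j = i
    · subst hj; simp [coarse, step, key.1]
    · simp [coarse, step, hj]
  · intro j
    by_cases hj : j = i
    · subst hj; simp [step, key.2]
    · simp [step, hj]

theorem coarse_step_of_eq {L : ℤ} (hL : 0 < L) {v : ZMod 3 → ℤ} {i : ZMod 3}
    (hi : v i % L = L - 1) : coarse L (step v i) = step (coarse L v) i ∧
      ∀ j, step v i j % L = if j = i then 0 else v j % L := by
  have key : (v i + 1) / L = v i / L + 1 ∧ (v i + 1) % L = 0 := by
    refine (Int.ediv_emod_unique hL).2 ⟨?_, le_rfl, hL⟩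
    linarith [Int.mul_ediv_add_emod (v i) L, mul_add L (v i / L) 1]
  constructor
  · funext j
    by_cases hj : j = i
    · subst hj; simp [coarse, step, key.1]
    · simp [coarse, step, hj]
  · intro j
    by_cases hj : j = i
    · subst hj; simp [step, key.2]
    · simp [step, hj]

/-- For `j ≠ i` the index `-i - j` is the third direction, and for `j = i` it is `i` itself:
reflection in side `i` fixes `i` and swaps the other two. -/
theorem label_step_apply {F : ZMod 3 → ℤ} (hF : total F = -2) (i j : ZMod 3) :
    label (step F i) (-i - j) = label F j := by
  have h : total (step F i) = -1 := by rw [total_step, hF]; rfl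
  have h1 : (1 : ZMod 3) ≠ 0 := by decide
  have h2 : (0 : ZMod 3) ≠ 1 := by decide
  have h3 : (0 : ZMod 3) ≠ 2 := by decide
  have h4 : (1 : ZMod 3) ≠ 2 := by decide
  have key : (((step F i) 0 - (step F i) 1 : ℤ) : ZMod 3) = ((F 0 - F 1 : ℤ) : ZMod 3) + i + 1 := by
    generalize hx : ((F 0 - F 1 : ℤ) : ZMod 3) = x
    rcases zmod_three_cases i with rfl | rfl | rfl
    · have : (step F 0) 0 - (step F 0) 1 = (F 0 - F 1) + 1 := by
        simp [step, h1]; ring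
      rw [this]; push_cast [← hx]; ring
    · have : (step F 1) 0 - (step F 1) 1 = (F 0 - F 1) - 1 := by
        simp [step, h2]; ring
      rw [this]; push_cast [← hx]
      linear_combination (-1 : ZMod 3) * zmod_three_eq_zero
    · have : (step F 2) 0 - (step F 2) 1 = (F 0 - F 1) := by
        simp [step, h3, h4]
      rw [this, hx]
      linear_combination (-1 : ZMod 3) * zmod_three_eq_zero
  simp only [label, Equiv.coe_fn_mk, h, hF, key]
  simp only [show ¬ ((-2 : ℤ) = -1) by decide, if_true, if_false]
  linear_combination (1 : ZMod 3) * zmod_three_eq_zero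

theorem label_step_self {F : ZMod 3 → ℤ} (hF : total F = -2) (i : ZMod 3) :
    label (step F i) i = label F i := by
  have h := label_step_apply hF i i
  rwa [show -i - i = i by linear_combination (-i) * zmod_three_eq_zero] at h

/-- Here the residues of `v` add up to `2L - 2`, so the two other than the `i`-th add up to `L - 1`.
Complementing them, as a downward triangle does, is the same as swapping them, as the reflection
does. -/
theorem fold_step_of_eq {L : ℤ} (hL : 0 < L) {v : ZMod 3 → ℤ} {i : ZMod 3} (hv : total v = -2)
    (hF : total (coarse L v) = -2) (hi : v i % L = L - 1) : fold L (step v i) = fold L v := by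
  obtain ⟨hc, hr⟩ := coarse_step_of_eq hL hi
  have hF' : total (coarse L (step v i)) = -1 := by rw [hc, total_step, hF]; rfl
  have hs : total (fun j => v j % L) = 2 * L - 2 := by
    have := total_eq_coarse L v
    rw [hF, hv] at this; linarith
  funext c
  obtain ⟨j, rfl⟩ := (label (coarse L v)).surjective c
  have e1 : (label (coarse L (step v i))).symm (label (coarse L v) j) = -i - j := by
    rw [Equiv.symm_apply_eq, hc, label_step_apply hF]
  simp only [fold, hF', hF, if_true, e1, Equiv.symm_apply_apply, hr,
    show ¬ ((-2 : ℤ) = -1) by decide, if_false]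
  simp only [total] at hs
  revert hi
  rcases zmod_three_cases i with rfl | rfl | rfl <;>
  rcases zmod_three_cases j with rfl | rfl | rfl <;> intro hi
  · rw [if_pos (by decide)]; omega
  · rw [if_neg (by decide), show (-0 - 1 : ZMod 3) = 2 by decide]; omega
  · rw [if_neg (by decide), show (-0 - 2 : ZMod 3) = 1 by decide]; omega
  · rw [if_neg (by decide), show (-1 - 0 : ZMod 3) = 2 by decide]; omega
  · rw [if_pos (by decide)]; omega
  · rw [if_neg (by decide), show (-1 - 2 : ZMod 3) = 0 by decide]; omega
  · rw [if_neg (by decide), show (-2 - 0 : ZMod 3) = 1 by decide]; omega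
  · rw [if_neg (by decide), show (-2 - 1 : ZMod 3) = 0 by decide]; omega
  · rw [if_pos (by decide)]; omega

/-- Patterns in all triangles with common boundary values can be combined to a matching. -/
theorem isMatching_glue {L : ℤ} (hL : 0 < L) {f : (ZMod 3 → ℤ) → (ZMod 3 → ℤ) → ZMod 3}
    (hf : ∀ F, IsTrianglePattern L (f F))
    (hb : ∀ F F' c R, (∀ d, 0 ≤ R d) → total R = L - 1 → R c = 0 → (f F R = c ↔ f F' R = c)) :
    IsMatching (glue L f) := by
  intro v hv i
  have hlt := Int.emod_lt_of_pos (v i) hL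
  rcases total_coarse hL (Or.inr hv) with hF | hF
  · have hi : v i % L < L - 1 := by
      by_contra hc
      have h1 := total_eq_coarse L v
      rw [hF, hv] at h1
      have h2 := fun j => Int.emod_nonneg (v j) hL.ne'
      have h3 : v i % L ≤ total (fun j => v j % L) := by
        have h0 := h2 0; have h1 := h2 1; have h2 := h2 2
        simp only [total]
        rcases zmod_three_cases i with rfl | rfl | rfl <;> linarith
      linarith
    obtain ⟨hc, hr⟩ := coarse_step_of_lt hL hi
    have e : fold L (step v i) = step (fold L v) (label (coarse L v) i) := by
      funext c
      simp only [fold, hc, hF, if_true, hr]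
      simp only [step, Equiv.symm_apply_eq, fold, hF, if_true]
      split_ifs <;> simp
    simp only [glue, hc, e, Equiv.symm_apply_eq]
    exact (hf _).1 _ (fold_nonneg hL v) (by rw [total_fold_up hF, hv]; ring) _
  · have ht := total_fold_down hF
    rw [hv] at ht
    by_cases hi : v i % L < L - 1
    · obtain ⟨hc, hr⟩ := coarse_step_of_lt hL hi
      have hF' : total (coarse L (step v i)) = -2 := by rw [hc, hF]
      have e : fold L v = step (fold L (step v i)) (label (coarse L v) i) := by
        funext c
        simp only [fold, hF, show ¬ ((-2 : ℤ) = -1) by decide, if_false]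
        simp only [step.eq_1 (fold L (step v i)), fold, hc, hF, hr, Equiv.symm_apply_eq,
          show ¬ ((-2 : ℤ) = -1) by decide, if_false]
        split_ifs <;> ring
      simp only [glue, hc, Equiv.symm_apply_eq]
      rw [e]
      refine ((hf _).1 _ (fold_nonneg hL _) ?_ _).symm
      rw [total_fold_down hF', total_step, hv]; ring
    · have hi' : v i % L = L - 1 := by omega
      have e := fold_step_of_eq hL hv hF hi'
      obtain ⟨hc, hr⟩ := coarse_step_of_eq hL hi'
      simp only [glue, e, Equiv.symm_apply_eq]
      rw [hc, label_step_self hF]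
      refine hb _ _ _ _ (fold_nonneg hL v) (by rw [ht]; ring) ?_
      simp [fold, hF, hi']

/-! ### Unfolding and extracting patterns -/

theorem apply_le_of_inTriangle {L : ℤ} {R : ZMod 3 → ℤ} (hR : InTriangle L R) (c : ZMod 3) :
    R c < L := by
  obtain ⟨h, ht⟩ := hR
  have h0 := h 0; have h1 := h 1; have h2 := h 2
  simp only [total] at ht
  rcases zmod_three_cases c with rfl | rfl | rfl <;> omega

theorem unfold_ediv_emod {L : ℤ} (hL : 0 < L) {F R : ZMod 3 → ℤ} (hR : InTriangle L R)
    (j : ZMod 3) : unfold L F R j / L = F j ∧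
      unfold L F R j % L = if total F = -1 then R (label F j) else L - 1 - R (label F j) := by
  have h0 := hR.1 (label F j)
  have h1 := apply_le_of_inTriangle hR (label F j)
  refine (Int.ediv_emod_unique hL).2 ⟨by rw [unfold, add_comm], ?_, ?_⟩ <;> split_ifs <;> omega

theorem coarse_unfold {L : ℤ} (hL : 0 < L) {F R : ZMod 3 → ℤ} (hR : InTriangle L R) :
    coarse L (unfold L F R) = F :=
  funext fun j => (unfold_ediv_emod hL hR j).1

theorem fold_unfold {L : ℤ} (hL : 0 < L) {F R : ZMod 3 → ℤ} (hR : InTriangle L R) :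
    fold L (unfold L F R) = R := by
  funext c
  simp only [fold, coarse_unfold hL hR, (unfold_ediv_emod hL hR _).2, Equiv.apply_symm_apply]
  split_ifs <;> ring

theorem unfold_fold (L : ℤ) (v : ZMod 3 → ℤ) : unfold L (coarse L v) (fold L v) = v := by
  funext j
  have h := Int.mul_ediv_add_emod (v j) L
  simp only [unfold, fold, Equiv.symm_apply_apply]
  simp only [coarse] at *
  split_ifs <;> linarith

theorem total_unfold_up {L : ℤ} {F : ZMod 3 → ℤ} (R : ZMod 3 → ℤ) (hF : total F = -1) :
    total (unfold L F R) = total R - L := by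
  have h := total_comp_equiv (label F) R
  have e : unfold L F R = fun j => L * F j + R (label F j) := by
    funext j; simp [unfold, hF]
  rw [← h, e]
  simp only [total] at *
  linear_combination L * hF

theorem total_unfold_down {L : ℤ} {F : ZMod 3 → ℤ} (R : ZMod 3 → ℤ) (hF : total F = -2) :
    total (unfold L F R) = L - 3 - total R := by
  have h := total_comp_equiv (label F) R
  have e : unfold L F R = fun j => L * F j + (L - 1 - R (label F j)) := by
    funext j; simp [unfold, hF]
  rw [← h, e]
  simp only [total] at *
  linear_combination L * hF

theorem isTrianglePattern_extract {L : ℤ} {τ : (ZMod 3 → ℤ) → ZMod 3}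
    (hτ : IsMatching τ) {F : ZMod 3 → ℤ} (hF : total F = -1 ∨ total F = -2) :
    IsTrianglePattern L (extract L τ F) := by
  refine ⟨fun R h0 ht c => ?_, fun R hR => by simp [extract, hR]⟩
  have hR : InTriangle L R := ⟨h0, Or.inr ht⟩
  have hR' : InTriangle L (step R c) := by
    refine ⟨fun d => ?_, Or.inl (by rw [total_step, ht]; ring)⟩
    have := h0 d
    simp only [step]; split_ifs <;> omega
  simp only [extract, hR, hR', if_true]
  simp only [← Equiv.eq_symm_apply]
  rcases hF with hF | hF
  · have e : unfold L F (step R c) = step (unfold L F R) ((label F).symm c) := by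
      funext j
      simp only [unfold, step, hF, if_true, Equiv.eq_symm_apply]
      split_ifs <;> ring
    rw [e]
    exact hτ _ (by rw [total_unfold_up R hF, ht]; ring) _
  · have e : unfold L F R = step (unfold L F (step R c)) ((label F).symm c) := by
      funext j
      simp only [unfold, step, hF, show ¬ ((-2 : ℤ) = -1) by decide, if_false, Equiv.eq_symm_apply]
      split_ifs <;> ring
    rw [e]
    exact (hτ _ (by rw [total_unfold_down _ hF, total_step, ht]; ring) _).symm

theorem label_symm_extract {L : ℤ} (hL : 0 < L) (τ : (ZMod 3 → ℤ) → ZMod 3) {v : ZMod 3 → ℤ}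
    (hv : total v = -1 ∨ total v = -2) :
    (label (coarse L v)).symm (extract L τ (coarse L v) (fold L v)) = τ v := by
  simp [extract, inTriangle_fold hL hv, unfold_fold]

theorem label_glue_unfold {L : ℤ} (hL : 0 < L) (f : (ZMod 3 → ℤ) → (ZMod 3 → ℤ) → ZMod 3)
    (F : ZMod 3 → ℤ) {R : ZMod 3 → ℤ} (hR : InTriangle L R) :
    label F (glue L f (unfold L F R)) = f F R := by
  simp [glue, coarse_unfold hL hR, fold_unfold hL hR]

/-! ### Permutations as matchings -/

/-- The three allowed movements, indexed by the directions of the honeycomb lattice. -/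
def move (i : ZMod 3) : cornerSet :=
  ⟨if i = 1 then (1, 0) else if i = 2 then (0, 1) else (0, 0), by revert i; decide⟩

/-- The direction of a movement. -/
def dir (a : cornerSet) : ZMod 3 := if a.1 = (1, 0) then 1 else if a.1 = (0, 1) then 2 else 0

theorem dir_move (i : ZMod 3) : dir (move i) = i := by revert i; decide

theorem move_dir (a : cornerSet) : move (dir a) = a := by revert a; decide

theorem dir_eq_iff (a : cornerSet) (i : ZMod 3) : dir a = i ↔ a.1 = (move i).1 := by
  constructor
  · rintro rfl; rw [move_dir]
  · intro h; rw [Subtype.ext h, dir_move]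

/-- The vector `(x, y, z)`. -/
def vec (x y z : ℤ) : ZMod 3 → ℤ := fun i => if i = 0 then x else if i = 1 then y else z

theorem vec_zero (x y z : ℤ) : vec x y z 0 = x := rfl
theorem vec_one (x y z : ℤ) : vec x y z 1 = y := rfl
theorem vec_two (x y z : ℤ) : vec x y z 2 = z := rfl

theorem total_vec (x y z : ℤ) : total (vec x y z) = x + y + z := rfl

theorem eq_vec_iff (v : ZMod 3 → ℤ) (x y z : ℤ) : v = vec x y z ↔ v 0 = x ∧ v 1 = y ∧ v 2 = z := by
  rw [funext_iff, forall_zmod_three]; rfl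

/-- The black vertex, the source of the movement at a site. -/
def black (m : ℤ × ℤ) : ZMod 3 → ℤ := vec (m.1 + m.2 + 1) (-m.1 - 1) (-m.2 - 1)

/-- The white vertex, the target of the movements to a site. -/
def white (m : ℤ × ℤ) : ZMod 3 → ℤ := vec (m.1 + m.2) (-m.1 - 1) (-m.2 - 1)

/-- The site of a vertex. -/
def site (v : ZMod 3 → ℤ) : ℤ × ℤ := (-v 1 - 1, -v 2 - 1)

/-- The translation of the honeycomb lattice which belongs to a translation of `ℤ²`. -/
def translation (m : ℤ × ℤ) : ZMod 3 → ℤ := vec (m.1 + m.2) (-m.1) (-m.2)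

theorem total_black (m : ℤ × ℤ) : total (black m) = -1 := by rw [black, total_vec]; ring

theorem total_white (m : ℤ × ℤ) : total (white m) = -2 := by rw [white, total_vec]; ring

theorem total_translation (m : ℤ × ℤ) : total (translation m) = 0 := by
  rw [translation, total_vec]; ring

theorem total_add (v w : ZMod 3 → ℤ) : total (v + w) = total v + total w := by
  simp only [total, Pi.add_apply]; ring

theorem site_black (m : ℤ × ℤ) : site (black m) = m := by
  ext <;> simp [site, black, vec_one, vec_two]

theorem black_site {v : ZMod 3 → ℤ} (hv : total v = -1) : black (site v) = v := by
  symm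
  rw [black, eq_vec_iff]
  simp only [total] at hv
  refine ⟨?_, ?_, ?_⟩ <;> simp only [site] <;> linarith

theorem white_site {v : ZMod 3 → ℤ} (hv : total v = -2) : white (site v) = v := by
  symm
  rw [white, eq_vec_iff]
  simp only [total] at hv
  refine ⟨?_, ?_, ?_⟩ <;> simp only [site] <;> linarith

theorem step_white (m : ℤ × ℤ) (i : ZMod 3) : step (white m) i = black (m - (move i).1) := by
  rw [black, eq_vec_iff]
  have h10 : (1 : ZMod 3) ≠ 0 := by decide
  have h20 : (2 : ZMod 3) ≠ 0 := by decide
  have h12 : (1 : ZMod 3) ≠ 2 := by decide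
  rcases zmod_three_cases i with rfl | rfl | rfl <;>
    simp [step, white, move, vec_zero, vec_one, vec_two, h10, h20, h12, h10.symm, h20.symm, h12.symm] <;>
    ring

theorem black_add (m n : ℤ × ℤ) : black (m + n) = black m + translation n := by
  symm
  rw [black.eq_1 (m + n), eq_vec_iff]
  refine ⟨?_, ?_, ?_⟩ <;>
    simp [black, translation, vec_zero, vec_one, vec_two] <;> ring

theorem step_add (v w : ZMod 3 → ℤ) (i : ZMod 3) : step (v + w) i = step v i + w := by
  funext j
  simp only [step, Pi.add_apply]
  split_ifs <;> ring

theorem IsMatching.translate {τ : (ZMod 3 → ℤ) → ZMod 3} (h : IsMatching τ) {s : ZMod 3 → ℤ}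
    (hs : total s = 0) : IsMatching fun v => τ (v + s) := fun v hv i => by
  simp only [← step_add]
  exact h _ (by rw [total_add, hv, hs]; rfl) i

/-- The partner of a white vertex is black and determines its edge. Off the honeycomb the values are
arbitrary. -/
theorem IsMatching.eq_of_black {τ τ' : (ZMod 3 → ℤ) → ZMod 3} (h : IsMatching τ)
    (h' : IsMatching τ') (hb : ∀ v, total v = -1 → τ v = τ' v) {v : ZMod 3 → ℤ}
    (hv : total v = -1 ∨ total v = -2) : τ v = τ' v := by
  rcases hv with hv | hv
  · exact hb v hv
  · have h1 := (h v hv (τ v)).1 rfl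
    rw [hb _ (by rw [total_step, hv]; rfl)] at h1
    exact ((h' v hv _).2 h1).symm

/-- The configuration of movements of a matching. -/
def config (τ : (ZMod 3 → ℤ) → ZMod 3) : ℤ × ℤ → cornerSet := fun m => move (τ (black m))

theorem config_mem_Omega {τ : (ZMod 3 → ℤ) → ZMod 3} (h : IsMatching τ) :
    config τ ∈ Omega cornerSet := by
  let π : Equiv.Perm (ℤ × ℤ) :=
    { toFun := fun m => m + (move (τ (black m))).1
      invFun := fun p => p - (move (τ (white p))).1
      left_inv := fun m => by
        have h1 := (h (white (m + (move (τ (black m))).1)) (total_white _) (τ (black m))).2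
          (by rw [step_white, add_sub_cancel_right])
        simp only [h1, add_sub_cancel_right]
      right_inv := fun p => by
        have h1 := (h (white p) (total_white p) (τ (white p))).1 rfl
        rw [step_white] at h1
        simp only [h1, sub_add_cancel] }
  have hπ : ∀ m, π m - m = (move (τ (black m))).1 := fun m => add_sub_cancel_left _ _
  refine ⟨⟨π, fun m => ?_⟩, ?_⟩
  · rw [hπ]; exact (move _).2
  · funext m; exact Subtype.ext (hπ m)

theorem exists_isMatching {ω : ℤ × ℤ → cornerSet} (hω : ω ∈ Omega cornerSet) :
    ∃ τ, IsMatching τ ∧ config τ = ω := by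
  obtain ⟨⟨π, hπ⟩, rfl⟩ := hω
  set ω := displacement cornerSet ⟨π, hπ⟩ with hω
  have hd : ∀ m, (ω m).1 = π m - m := fun m => rfl
  -- A white vertex takes the movement that arrives at its site, which starts at the preimage under
  -- `π`.
  refine ⟨fun v => if total v = -1 then dir (ω (site v)) else dir (ω (π.symm (site v))),
    fun v hv i => ?_, ?_⟩
  · have ht : total (step v i) = -1 := by rw [total_step, hv]; rfl
    have hs : site (step v i) = site v - (move i).1 := by
      conv_lhs => rw [← white_site hv, step_white, site_black]
    simp only [hv, show ¬ ((-2 : ℤ) = -1) by decide, if_false, ht, if_true, hs, dir_eq_iff, hd,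
      Equiv.apply_symm_apply]
    constructor
    · intro h
      have e : site v - (move i).1 = π.symm (site v) := by rw [← h, sub_sub_cancel]
      rw [e, Equiv.apply_symm_apply, h]
    · intro h
      have e : π.symm (site v) = site v - (move i).1 := by
        rw [Equiv.symm_apply_eq, sub_eq_iff_eq_add.1 h, add_sub_cancel]
      rw [e, sub_sub_cancel]
  · funext m
    simp [config, total_black, site_black, move_dir]

theorem shift_mem_Omega {ω : ℤ × ℤ → cornerSet} (hω : ω ∈ Omega cornerSet) (n : ℤ × ℤ) :
    (fun m => ω (m + n)) ∈ Omega cornerSet := by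
  obtain ⟨τ, hτ, rfl⟩ := exists_isMatching hω
  have h := config_mem_Omega (hτ.translate (total_translation n))
  convert h using 1
  funext m
  simp only [config, black_add]

theorem config_mem_fixedBySubgroup {τ : (ZMod 3 → ℤ) → ZMod 3} (h : IsMatching τ)
    {Γ : AddSubgroup (ℤ × ℤ)} (hΓ : ∀ n ∈ Γ, ∀ v, τ (v + translation n) = τ v) :
    config τ ∈ fixedBySubgroup Γ (Omega cornerSet) := by
  refine ⟨config_mem_Omega h, fun n hn => ?_⟩
  funext m
  simp only [SymbolicDynamics.FullShift.shift_apply, config]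
  rw [add_comm, black_add, hΓ n hn]

/-- With `total d = 0` and `d 0 ≡ d 1` modulo 3, the translation by `L d` preserves the
triangulation together with its labels. -/
theorem glue_add {L : ℤ} (hL : 0 < L) {f : (ZMod 3 → ℤ) → (ZMod 3 → ℤ) → ZMod 3}
    {d : ZMod 3 → ℤ} (hd : total d = 0) (h3 : ((d 0 - d 1 : ℤ) : ZMod 3) = 0)
    (hf : ∀ F, f (F + d) = f F) {w : ZMod 3 → ℤ} (hw : ∀ j, w j = L * d j) (v : ZMod 3 → ℤ) :
    glue L f (v + w) = glue L f v := by
  have hc : coarse L (v + w) = coarse L v + d := by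
    funext j
    simp only [coarse, Pi.add_apply, hw]
    rw [Int.add_mul_ediv_left _ _ hL.ne']
  have hr : ∀ j, (v + w) j % L = v j % L := fun j => by
    simp only [Pi.add_apply, hw, Int.add_mul_emod_self_left]
  have ht : total (coarse L v + d) = total (coarse L v) := by rw [total_add, hd, add_zero]
  have hκ : (((coarse L v + d) 0 - (coarse L v + d) 1 : ℤ) : ZMod 3) =
      ((coarse L v 0 - coarse L v 1 : ℤ) : ZMod 3) := by
    have : (coarse L v + d) 0 - (coarse L v + d) 1 =
      (coarse L v 0 - coarse L v 1) + (d 0 - d 1) := by simp only [Pi.add_apply]; ring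
    rw [this, Int.cast_add, h3, add_zero]
  have hl : label (coarse L v + d) = label (coarse L v) := by
    ext i
    simp only [label, Equiv.coe_fn_mk, ht, hκ]
  have hfold : fold L (v + w) = fold L v := by
    funext c
    simp only [fold, hc, ht, hl, hr]
  simp only [glue, hfold, hc, hl, hf]

/-! ### Counting by covering with boxes -/

theorem ncard_image_le_of_determined {α β γ : Type*} [Finite γ] {X : Set α} {f : α → β}
    (Φ : X → γ) (h : ∀ x y : X, Φ x = Φ y → f x = f y) :
    (f '' X).Finite ∧ (f '' X).ncard ≤ Nat.card γ := by
  choose g hg using fun b : f '' X => b.2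
  have hinj : Function.Injective fun b : f '' X => Φ ⟨g b, (hg b).1⟩ := fun b b' hb => by
    have := h _ _ hb
    exact Subtype.ext (by rw [← (hg b).2, ← (hg b').2]; exact this)
  exact ⟨Set.finite_coe_iff.1 (Finite.of_injective _ hinj), Nat.card_le_card_of_injective _ hinj⟩

/-- By shift invariance each translated box shows one of the patterns of `box M`. -/
theorem ncard_image_le_patterns_pow {ι β : Type*} [Fintype ι] {Y : Set (ℤ × ℤ → cornerSet)}
    (hY : Y ⊆ Omega cornerSet) (M : ℕ) (t : ι → ℤ × ℤ) {f : (ℤ × ℤ → cornerSet) → β}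
    (h : ∀ ω ∈ Y, ∀ ω' ∈ Y, (∀ i, ∀ n ∈ box M, ω (n + t i) = ω' (n + t i)) → f ω = f ω') :
    (f '' Y).Finite ∧
      (f '' Y).ncard ≤ (patterns (Omega cornerSet) (box M)).ncard ^ Fintype.card ι := by
  have := ncard_image_le_of_determined (X := Y) (f := f)
    (γ := ι → patterns (Omega cornerSet) (box M))
    (fun ω i => ⟨fun n => ω.1 (n + t i), _, shift_mem_Omega (hY ω.2) (t i), rfl⟩)
    (fun ω ω' hω => h _ ω.2 _ ω'.2 fun i n hn =>
      congrFun (congrArg Subtype.val (congrFun hω i)) ⟨n, hn⟩)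
  rwa [Nat.card_fun, Nat.card_eq_fintype_card (α := ι)] at this

theorem mem_box {n : ℕ} {m : ℤ × ℤ} :
    m ∈ box n ↔ (0 ≤ m.1 ∧ m.1 < n) ∧ 0 ≤ m.2 ∧ m.2 < n := by
  simp [box]

theorem ediv_toNat_lt {L n : ℕ} {x : ℤ} (h0 : 0 ≤ x) (hx : x < n) :
    (x / L).toNat < n / L + 1 := by
  obtain ⟨k, rfl⟩ := Int.eq_ofNat_of_zero_le h0
  rw [← Int.natCast_ediv, Int.toNat_natCast, Nat.lt_succ_iff]
  exact Nat.div_le_div_right (by omega)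

theorem ncard_patterns_le_pow {m : ℕ} (hm : 0 < m) (n : ℕ) :
    (patterns (Omega cornerSet) (box n)).ncard ≤
      (patterns (Omega cornerSet) (box m)).ncard ^ (n / m + 1) ^ 2 := by
  have := (ncard_image_le_patterns_pow (ι := Fin (n / m + 1) × Fin (n / m + 1)) subset_rfl m
    (fun i => ((m : ℤ) * i.1, (m : ℤ) * i.2))
    (f := fun (ω : ℤ × ℤ → cornerSet) => fun k : box n => ω k) ?_).2
  · simpa [patterns, sq] using this
  · intro ω _ ω' _ h
    funext ⟨k, hk⟩
    rw [mem_box] at hk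
    have hm' : (0 : ℤ) < m := by exact_mod_cast hm
    have := h (⟨(k.1 / m).toNat, ediv_toNat_lt hk.1.1 hk.1.2⟩,
      ⟨(k.2 / m).toNat, ediv_toNat_lt hk.2.1 hk.2.2⟩) (k.1 % m, k.2 % m)
      (mem_box.2 ⟨⟨Int.emod_nonneg _ hm'.ne', Int.emod_lt_of_pos _ hm'⟩,
        Int.emod_nonneg _ hm'.ne', Int.emod_lt_of_pos _ hm'⟩)
    have e : ((k.1 % m, k.2 % m) : ℤ × ℤ) + ((m : ℤ) * ((k.1 / m).toNat : ℤ),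
        (m : ℤ) * ((k.2 / m).toNat : ℤ)) = k := by
      rw [Int.toNat_of_nonneg (Int.ediv_nonneg hk.1.1 hm'.le),
        Int.toNat_of_nonneg (Int.ediv_nonneg hk.2.1 hm'.le)]
      ext <;> simp [Int.emod_add_mul_ediv]
    simp only [e] at this
    exact this

theorem mem_Delta_iff (K : ℕ) (v : ℤ × ℤ) : v ∈ Delta K ↔ ∃ k l : ℤ,
    v = (2 * k * ((K : ℤ) ^ 3 + 2 * K) + 2 * l * K, 2 * l * (K : ℤ)) := by
  change (∃ k l : ℤ, _) ↔ _
  simp [Prod.ext_iff]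

theorem finite_fixedBySubgroup_Delta {K : ℕ} (hK : 0 < K) :
    (fixedBySubgroup (Delta K) (Omega cornerSet)).Finite ∧
    (fixedBySubgroup (Delta K) (Omega cornerSet)).ncard ≤
      (patterns (Omega cornerSet) (box (2 * K))).ncard ^ (K ^ 2 + 2) := by
  have := (ncard_image_le_patterns_pow (ι := Fin (K ^ 2 + 2))
    (Y := fixedBySubgroup (Delta K) (Omega cornerSet)) (fun ω h => h.1) (2 * K)
    (fun i => (((2 * K : ℕ) : ℤ) * i, 0)) (f := id) ?_)
  · simpa using this
  · intro ω hω ω' hω' h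
    funext n
    have hM : (0 : ℤ) < ((2 * K : ℕ) : ℤ) := by positivity
    set M : ℤ := ((2 * K : ℕ) : ℤ) with hMd
    have hP : (0 : ℤ) < K ^ 2 + 2 := by positivity
    -- A multiple of `(M, M)` brings the second coordinate into `[0, M)`. Then `d` counts boxes
    -- along the row and matters only modulo `K² + 2`.
    set x := n.1 - M * (n.2 / M) with hx
    set d := x / M with hd
    have key : ∀ ω ∈ fixedBySubgroup (Delta K) (Omega cornerSet),
        ω ((x % M, n.2 % M) + (M * (d % (K ^ 2 + 2)), 0)) = ω n := by
      intro ω hω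
      have h1 := congrFun (hω.2 (M * (n.2 / M) + M * (K ^ 2 + 2) * (d / (K ^ 2 + 2)), M * (n.2 / M))
        ((mem_Delta_iff K _).2 ⟨d / (K ^ 2 + 2), n.2 / M, ?_⟩))
        ((x % M, n.2 % M) + (M * (d % (K ^ 2 + 2)), 0))
      · rw [SymbolicDynamics.FullShift.shift_apply] at h1
        rw [← h1]
        congr 1
        have e1 := Int.mul_ediv_add_emod x M
        have e2 := Int.mul_ediv_add_emod n.2 M
        have e3 := Int.mul_ediv_add_emod d (K ^ 2 + 2)
        rw [← hd] at e1
        ext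
        · simp only [Prod.fst_add]
          linear_combination e1 + hx + M * e3
        · simp only [Prod.snd_add]
          linear_combination e2
      · rw [hMd]; push_cast
        ext <;> simp <;> ring
    have h1 := h ⟨(d % (K ^ 2 + 2)).toNat, by
      have := Int.emod_lt_of_pos d hP
      have := Int.emod_nonneg d hP.ne'
      zify; rwa [Int.toNat_of_nonneg this]⟩ (x % M, n.2 % M)
      (mem_box.2 ⟨⟨Int.emod_nonneg _ hM.ne', Int.emod_lt_of_pos _ hM⟩,
        Int.emod_nonneg _ hM.ne', Int.emod_lt_of_pos _ hM⟩)
    simp only [Int.toNat_of_nonneg (Int.emod_nonneg d hP.ne')] at h1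
    rwa [key ω hω, key ω' hω'] at h1

/-- In the coordinates `(x - y, y)` the subgroup is a product. -/
theorem index_Delta (K : ℕ) :
    (Delta K).index = 2 * (K ^ 3 + 2 * K) * (2 * K) := by
  let φ : ℤ × ℤ →+ ZMod (2 * (K ^ 3 + 2 * K)) × ZMod (2 * K) :=
    { toFun := fun v => (Int.cast (v.1 - v.2), Int.cast v.2)
      map_zero' := by simp
      map_add' := fun v w => by ext <;> simp; ring }
  have hker : φ.ker = Delta K := by
    ext v
    rw [AddMonoidHom.mem_ker, mem_Delta_iff]
    change ((Int.cast (v.1 - v.2), Int.cast v.2) :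
      ZMod (2 * (K ^ 3 + 2 * K)) × ZMod (2 * K)) = (0, 0) ↔ _
    rw [Prod.mk.injEq, ZMod.intCast_zmod_eq_zero_iff_dvd, ZMod.intCast_zmod_eq_zero_iff_dvd]
    push_cast
    constructor
    · rintro ⟨⟨k, hk⟩, l, hl⟩
      refine ⟨k, l, ?_⟩
      ext
      · linear_combination hk + hl
      · linear_combination hl
    · rintro ⟨k, l, rfl⟩
      exact ⟨⟨k, by ring⟩, l, by ring⟩
  have hsurj : Function.Surjective φ := fun ⟨a, b⟩ => by
    obtain ⟨x, rfl⟩ := ZMod.intCast_surjective a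
    obtain ⟨y, rfl⟩ := ZMod.intCast_surjective b
    exact ⟨(x + y, y), by simp [φ]⟩
  rw [← hker, AddSubgroup.index_ker, AddMonoidHom.range_eq_top.2 hsurj, AddSubgroup.card_top,
    Nat.card_prod, Nat.card_zmod, Nat.card_zmod]

/-! ### Counting triangle patterns -/

theorem finite_inTriangle (L : ℤ) : {R | InTriangle L R}.Finite :=
  (Set.finite_Icc (0 : ZMod 3 → ℤ) fun _ => L).subset fun _ hR =>
    ⟨fun c => hR.1 c, fun c => (apply_le_of_inTriangle hR c).le⟩

instance finite_trianglePattern (L : ℤ) : Finite {p // IsTrianglePattern L p} := by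
  have := (finite_inTriangle L).to_subtype
  refine Finite.of_injective (β := {R | InTriangle L R} → ZMod 3) (fun p R => p.1 R) ?_
  intro p q h
  refine Subtype.ext (funext fun R => ?_)
  by_cases hR : InTriangle L R
  · exact congrFun h ⟨R, hR⟩
  · rw [p.2.2 R hR, q.2.2 R hR]

/-- A triangle with given second and third coordinates, upward or downward. -/
def triangleAt (a b : ℤ) (up : Bool) : ZMod 3 → ℤ := vec ((if up then -1 else -2) - a - b) a b

theorem total_triangleAt (a b : ℤ) (up : Bool) :
    total (triangleAt a b up) = if up then -1 else -2 := by
  rw [triangleAt, total_vec]; ring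

theorem triangleAt_eq {F : ZMod 3 → ℤ} (hF : total F = -1 ∨ total F = -2) :
    triangleAt (F 1) (F 2) (decide (total F = -1)) = F := by
  symm
  rw [triangleAt, eq_vec_iff]
  refine ⟨?_, rfl, rfl⟩
  rcases hF with h | h
  · simp only [h, decide_true, if_true]; simp only [total] at h; linarith
  · simp only [h, show ¬ ((-2 : ℤ) = -1) by decide, decide_false, Bool.false_eq_true, if_false]
    simp only [total] at h; linarith

/-- A coarse cell is the union of an upward and a downward triangle, whence the square; at most `(n
/ L + 1)²` cells meet the box. -/
theorem ncard_patterns_le_trianglePattern_pow {L : ℕ} (hL : 0 < L) (n : ℕ) :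
    (patterns (Omega cornerSet) (box n)).ncard ≤
      (Nat.card {p // IsTrianglePattern L p} ^ 2) ^ (n / L + 1) ^ 2 := by
  have hL' : (0 : ℤ) < L := by exact_mod_cast hL
  choose τ hτ hc using fun ω : Omega cornerSet => exists_isMatching ω.2
  have hF : ∀ a b up, total (triangleAt a b up) = -1 ∨ total (triangleAt a b up) = -2 := by
    intro a b up; rw [total_triangleAt]; cases up <;> simp
  have := (ncard_image_le_of_determined (X := Omega cornerSet)
    (f := fun (ω : ℤ × ℤ → cornerSet) => fun k : box n => ω k)
    (γ := Fin (n / L + 1) × Fin (n / L + 1) × Bool → {p // IsTrianglePattern L p})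
    (fun ω i => ⟨extract L (τ ω) (triangleAt (-(i.1 : ℤ) - 1) (-(i.2.1 : ℤ) - 1) i.2.2),
      isTrianglePattern_extract (hτ ω) (hF _ _ _)⟩) ?_).2
  · rw [Nat.card_fun, Nat.card_prod, Nat.card_prod, Nat.card_fin, Nat.card_eq_fintype_card (α := Bool),
      Fintype.card_bool] at this
    rw [← pow_mul]
    rwa [show 2 * (n / L + 1) ^ 2 = (n / L + 1) * ((n / L + 1) * 2) by ring]
  · intro ω ω' h
    funext ⟨k, hk⟩
    rw [mem_box] at hk
    have hk1 : ((k.1 / L).toNat : ℤ) = k.1 / L := Int.toNat_of_nonneg (Int.ediv_nonneg hk.1.1 hL'.le)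
    have hk2 : ((k.2 / L).toNat : ℤ) = k.2 / L := Int.toNat_of_nonneg (Int.ediv_nonneg hk.2.1 hL'.le)
    have hdiv : ∀ x : ℤ, (-x - 1) / L = -(x / L) - 1 := fun x => by
      refine ((Int.ediv_emod_unique (r := L - 1 - x % L) hL').2 ⟨?_, ?_, ?_⟩).1
      · linarith [Int.mul_ediv_add_emod x L]
      · linarith [Int.emod_lt_of_pos x hL']
      · linarith [Int.emod_nonneg x hL'.ne']
    have e := congrArg Subtype.val (congrFun h (⟨(k.1 / L).toNat, ediv_toNat_lt hk.1.1 hk.1.2⟩,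
      ⟨(k.2 / L).toNat, ediv_toNat_lt hk.2.1 hk.2.2⟩, decide (total (coarse L (black k)) = -1)))
    have ht := total_coarse hL' (Or.inl (total_black k))
    have e2 : triangleAt (-((k.1 / L).toNat : ℤ) - 1) (-((k.2 / L).toNat : ℤ) - 1)
        (decide (total (coarse L (black k)) = -1)) = coarse L (black k) := by
      conv_rhs => rw [← triangleAt_eq ht]
      rw [hk1, hk2, ← hdiv, ← hdiv]
      rfl
    simp only [e2] at e
    have hv := Or.inl (b := total (black k) = -2) (total_black k)
    change ω.1 k = ω'.1 k
    rw [← hc ω, ← hc ω']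
    simp only [config]
    rw [← label_symm_extract hL' (τ ω) hv, ← label_symm_extract hL' (τ ω') hv, e]

/-- The `k`-th vertex along a side of the reference triangle. -/
def sideVertex (L : ℤ) (c : ZMod 3) (k : ℤ) : ZMod 3 → ℤ := fun j =>
  if j = c then 0 else if j = c + 1 then k else L - 1 - k

theorem eq_sideVertex {L : ℤ} {R : ZMod 3 → ℤ} {c : ZMod 3} (ht : total R = L - 1)
    (hc : R c = 0) : R = sideVertex L c (R (c + 1)) := by
  funext j
  have h10 : (1 : ZMod 3) ≠ 0 := by decide
  have h20 : (2 : ZMod 3) ≠ 0 := by decide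
  have h12 : (1 : ZMod 3) ≠ 2 := by decide
  have e1 : (1 : ZMod 3) + 1 = 2 := by decide
  have e2 : (2 : ZMod 3) + 1 = 0 := by decide
  simp only [total] at ht
  revert hc
  rcases zmod_three_cases c with rfl | rfl | rfl <;>
  rcases zmod_three_cases j with rfl | rfl | rfl <;> intro hc <;>
    simp [sideVertex, e1, e2, h10, h20, h12, h10.symm, h20.symm, h12.symm] at hc ⊢ <;> linarith

/-- Many triangle patterns have the same boundary values. -/
theorem exists_common_boundary (L : ℕ) : ∃ S : Set {p // IsTrianglePattern L p},
    (∀ p ∈ S, ∀ q ∈ S, ∀ c R, (∀ d, 0 ≤ R d) → total R = L - 1 → R c = 0 →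
      (p.1 R = c ↔ q.1 R = c)) ∧
    Nat.card {p // IsTrianglePattern L p} ≤ 2 ^ (3 * L) * Nat.card S := by
  classical
  have := Fintype.ofFinite {p // IsTrianglePattern L p}
  -- For each of the `3L` side vertices, one bit tells whether its edge crosses that side.
  let g : {p // IsTrianglePattern L p} → (ZMod 3 × Fin L → Bool) := fun p i =>
    decide (p.1 (sideVertex L i.1 i.2) = i.1)
  obtain ⟨b, hb⟩ := Fintype.exists_le_card_fiber_of_nsmul_le_card g
    (b := (Fintype.card {p // IsTrianglePattern L p} : ℝ) / 2 ^ (3 * L)) (by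
      have : Fintype.card (ZMod 3 × Fin L → Bool) = 2 ^ (3 * L) := by
        rw [Fintype.card_fun, Fintype.card_prod, ZMod.card, Fintype.card_fin, Fintype.card_bool]
      rw [this, nsmul_eq_mul]
      push_cast
      rw [mul_div_cancel₀ _ (by positivity)])
  refine ⟨{p | g p = b}, fun p hp q hq c R h0 ht hc => ?_, ?_⟩
  · have e := eq_sideVertex ht hc
    have hR : R (c + 1) < L := apply_le_of_inTriangle ⟨h0, Or.inl ht⟩ _
    have h1 := h0 (c + 1)
    have hg : g p = g q := hp.trans hq.symm
    have h2 := congrFun hg (c, ⟨(R (c + 1)).toNat, by omega⟩)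
    simp only [g, decide_eq_decide, Int.toNat_of_nonneg h1, ← e] at h2
    exact h2
  · rw [div_le_iff₀ (by positivity), mul_comm] at hb
    rw [Nat.card_eq_fintype_card, Nat.card_eq_fintype_card, ← Set.toFinset_card]
    have e : {p | g p = b}.toFinset = Finset.univ.filter fun p => g p = b := by ext; simp
    rw [e]
    exact_mod_cast hb

/-! ### Gluing periodically -/

theorem translation_of_mem_Delta {K : ℕ} {L n m : ℤ} (hm : 2 * (K : ℤ) = L * m)
    (hn : 2 * ((K : ℤ) ^ 3 + 2 * K) = L * (3 * n)) {v : ℤ × ℤ} (hv : v ∈ Delta K) :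
    ∃ k l : ℤ, ∀ j, translation v j = L * translation (3 * n * k + m * l, m * l) j := by
  obtain ⟨k, l, rfl⟩ := (mem_Delta_iff K v).1 hv
  refine ⟨k, l, forall_zmod_three.2 ⟨?_, ?_, ?_⟩⟩ <;>
    simp only [translation, vec_zero, vec_one, vec_two]
  · linear_combination k * hn + 2 * l * hm
  · linear_combination -k * hn - l * hm
  · linear_combination -l * hm

theorem glue_add_translation {K : ℕ} {L n m : ℤ} (hL : 0 < L) (hm : 2 * (K : ℤ) = L * m)
    (hn : 2 * ((K : ℤ) ^ 3 + 2 * K) = L * (3 * n))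
    {f : (ZMod 3 → ℤ) → (ZMod 3 → ℤ) → ZMod 3}
    (hf : ∀ F (k l : ℤ), f (F + translation (3 * n * k + m * l, m * l)) = f F)
    {w : ℤ × ℤ} (hw : w ∈ Delta K) (v : ZMod 3 → ℤ) :
    glue L f (v + translation w) = glue L f v := by
  obtain ⟨k, l, h⟩ := translation_of_mem_Delta hm hn hw
  refine glue_add hL (total_translation _) ?_ (fun F => hf F k l) h v
  rw [ZMod.intCast_zmod_eq_zero_iff_dvd]
  exact ⟨2 * n * k + m * l, by simp only [translation, vec_zero, vec_one]; push_cast; ring⟩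

/-- Modulo `Δ_K` there are `3n · m` cells with two triangles each, and every triangle class may
carry any pattern of `S`. -/
theorem pow_le_ncard_fixedBySubgroup {K L n m : ℕ} (hK : 0 < K) (hL : 0 < L)
    (hm : 2 * K = L * m) (hn : 2 * (K ^ 3 + 2 * K) = L * (3 * n))
    (S : Set {p // IsTrianglePattern L p})
    (hS : ∀ p ∈ S, ∀ q ∈ S, ∀ c R, (∀ d, 0 ≤ R d) → total R = L - 1 → R c = 0 →
      (p.1 R = c ↔ q.1 R = c)) :
    Nat.card S ^ (3 * n * m * 2) ≤ (fixedBySubgroup (Delta K) (Omega cornerSet)).ncard := by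
  have hL' : (0 : ℤ) < L := by exact_mod_cast hL
  have hm0 : m ≠ 0 := by rintro rfl; omega
  have hn0 : n ≠ 0 := by
    rintro rfl
    have : 0 < K ^ 3 := by positivity
    omega
  have : NeZero m := ⟨hm0⟩
  have : NeZero (3 * n) := ⟨by omega⟩
  let cls : (ZMod 3 → ℤ) → ZMod (3 * n) × ZMod m × Bool := fun F =>
    (Int.cast (F 1 - F 2), Int.cast (F 2), decide (total F = -1))
  let G : (ZMod (3 * n) × ZMod m × Bool → S) → (ZMod 3 → ℤ) → ZMod 3 := fun g =>
    glue L fun F => (g (cls F)).1.1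
  have hG : ∀ g, IsMatching (G g) := fun g =>
    isMatching_glue hL' (fun F => (g (cls F)).1.2)
      fun F F' => hS _ (g (cls F)).2 _ (g (cls F')).2
  have hcls : ∀ F (k l : ℤ),
      cls (F + translation (3 * (n : ℤ) * k + (m : ℤ) * l, (m : ℤ) * l)) = cls F := by
    intro F k l
    simp only [cls, total_add, total_translation, add_zero, Prod.mk.injEq, and_true]
    simp only [Pi.add_apply, translation, vec_one, vec_two, ZMod.intCast_eq_intCast_iff_dvd_sub]
    exact ⟨⟨k, by push_cast; ring⟩, ⟨l, by ring⟩⟩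
  have hfix : ∀ g, config (G g) ∈ fixedBySubgroup (Delta K) (Omega cornerSet) := fun g =>
    config_mem_fixedBySubgroup (hG g) fun w hw v =>
      glue_add_translation (n := n) (m := m) hL' (by exact_mod_cast hm) (by exact_mod_cast hn)
        (fun F k l => by rw [hcls]) hw v
  have hfin := (finite_fixedBySubgroup_Delta hK).1.to_subtype
  have hinj : Function.Injective fun g =>
      (⟨config (G g), hfix g⟩ : fixedBySubgroup (Delta K) (Omega cornerSet)) := by
    intro g g' h
    have hb : ∀ v, total v = -1 → G g v = G g' v := fun v hv => by
      have := congrArg dir (congrFun (congrArg Subtype.val h) (site v))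
      simpa only [config, dir_move, black_site hv] using this
    funext ⟨a, b, up⟩
    obtain ⟨y, rfl⟩ := ZMod.intCast_surjective b
    obtain ⟨x, rfl⟩ := ZMod.intCast_surjective a
    have hF : total (triangleAt (x + y) y up) = -1 ∨ total (triangleAt (x + y) y up) = -2 := by
      rw [total_triangleAt]; cases up <;> simp
    have hc : cls (triangleAt (x + y) y up) = (Int.cast x, Int.cast y, up) := by
      simp only [cls, total_triangleAt]
      simp only [triangleAt, vec_one, vec_two, add_sub_cancel_right]
      cases up <;> rfl
    rw [← hc]
    refine Subtype.ext (Subtype.ext (funext fun R => ?_))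
    by_cases hR : InTriangle L R
    · have h1 := label_glue_unfold hL' (fun F => (g (cls F)).1.1) (triangleAt (x + y) y up) hR
      have h2 := label_glue_unfold hL' (fun F => (g' (cls F)).1.1) (triangleAt (x + y) y up) hR
      rw [← h1, ← h2]
      congr 1
      refine (hG g).eq_of_black (hG g') hb ?_
      rcases hF with hF | hF
      · rw [total_unfold_up R hF]
        rcases hR.2 with h | h <;> omega
      · rw [total_unfold_down R hF]
        rcases hR.2 with h | h <;> omega
    · rw [(g _).1.2.2 R hR, (g' _).1.2.2 R hR]
  have := Nat.card_le_card_of_injective _ hinj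
  rw [Nat.card_fun, Nat.card_prod, Nat.card_prod, Nat.card_zmod, Nat.card_zmod,
    Nat.card_eq_fintype_card (α := Bool), Fintype.card_bool, ← mul_assoc] at this
  exact this

/-! ### Density of periodic points -/

theorem mem_periodicPoints_of_shifted_triangle {τ : (ZMod 3 → ℤ) → ZMod 3} (hτ : IsMatching τ)
    {l : ℕ} (hl : 0 < l) : ∃ ω ∈ Omega cornerSet, ω ∈ periodicPoints (Omega cornerSet) ∧
      ∀ m : ℤ × ℤ, |m.1| + |m.2| + 1 < l → ω m = config τ m := by
  have hl' : (0 : ℤ) < l := by exact_mod_cast hl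
  have hL : (0 : ℤ) < 3 * l := by positivity
  -- Translation by `s` moves the origin well inside the triangle `F` of side `3l`, at distance
  -- about `l` from each side.
  let s : ZMod 3 → ℤ := vec (-2 * l) l l
  let F : ZMod 3 → ℤ := vec (-1) 0 0
  have hs : total s = 0 := by simp only [s, total_vec]; ring
  have hs' : total (-s) = 0 := by
    have := total_add s (-s)
    rw [add_neg_cancel, hs] at this
    simpa [total] using this.symm
  have hF : total F = -1 := by simp [F, total_vec]
  have hp := isTrianglePattern_extract (L := 3 * l) (hτ.translate hs') (Or.inl hF)
  set p := extract (3 * l) (fun v => τ (v + -s)) F with hpd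
  have hm : IsMatching fun v => glue (3 * l) (fun _ => p) (v + s) :=
    (isMatching_glue hL (fun _ => hp) fun _ _ _ _ _ _ _ => Iff.rfl).translate hs
  -- `K = 9l` makes both generators of `Δ_K` compatible with side `3l` and with the colouring.
  have hfix := config_mem_fixedBySubgroup hm (Γ := Delta (9 * l)) fun w hw v => by
    rw [add_right_comm]
    exact glue_add_translation (n := 2 * (81 * l ^ 2 + 2)) (m := 6) hL (by push_cast; ring)
      (by push_cast; ring) (fun _ _ _ => rfl) hw _
  refine ⟨_, hfix.1, ⟨_, ⟨?_⟩, hfix⟩, fun m hm => ?_⟩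
  · rw [index_Delta]; positivity
  · have hc : coarse (3 * l) (black m + s) = F := by
      have h1 := abs_le.1 (le_refl |m.1|)
      have h2 := abs_le.1 (le_refl |m.2|)
      have key : ∀ x q : ℤ, 3 * l * q ≤ x → x < 3 * l * q + 3 * l → x / (3 * l) = q :=
        fun x q h h' => ((Int.ediv_emod_unique (r := x - 3 * l * q) hL).2
          ⟨by ring, by linarith, by linarith⟩).1
      rw [eq_vec_iff]
      refine ⟨key _ _ ?_ ?_, key _ _ ?_ ?_, key _ _ ?_ ?_⟩ <;>
        simp only [Pi.add_apply, black, s, vec_zero, vec_one, vec_two] <;> linarith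
    have hv : total (black m + s) = -1 ∨ total (black m + s) = -2 := by
      rw [total_add, total_black, hs]; exact Or.inl rfl
    have := label_symm_extract hL (fun v => τ (v + -s)) hv
    rw [add_neg_cancel_right] at this
    simp only [config, glue, hpd]
    rw [← this, hc]

theorem dense_periodicPoints : Dense {ω : Omega cornerSet |
    (ω : ℤ × ℤ → cornerSet) ∈ periodicPoints (Omega cornerSet)} := by
  rintro ⟨ω, hω⟩
  obtain ⟨τ, hτ, rfl⟩ := exists_isMatching hω
  choose x hx hper hagree using fun j : ℕ => mem_periodicPoints_of_shifted_triangle hτ j.succ_pos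
  refine mem_closure_of_tendsto (b := atTop) (f := fun j => ⟨x j, hx j⟩) ?_
    (Eventually.of_forall hper)
  rw [tendsto_subtype_rng, tendsto_pi_nhds]
  intro m
  refine tendsto_nhds_of_eventually_eq ?_
  filter_upwards [eventually_ge_atTop (|m.1| + |m.2| + 1).toNat] with j hj
  exact hagree j m (by push_cast; omega)

/-! ### Existence of the entropy limit -/

theorem Omega_nonempty : (Omega cornerSet).Nonempty :=
  ⟨_, ⟨⟨1, fun n => by rw [Equiv.Perm.one_apply, sub_self]; decide⟩, rfl⟩⟩

theorem ncard_patterns_pos (n : ℕ) : 0 < (patterns (Omega cornerSet) (box n)).ncard :=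
  (Set.ncard_pos (Set.toFinite _)).2 (Omega_nonempty.image _)

theorem patternRate_nonneg (n : ℕ) : 0 ≤ patternRate (Omega cornerSet) n := by
  have : (1 : ℝ) ≤ (patterns (Omega cornerSet) (box n)).ncard := by
    exact_mod_cast ncard_patterns_pos n
  exact div_nonneg (Real.log_nonneg this) (by positivity)

theorem patternRate_le {L C : ℕ}
    (h : ∀ n, (patterns (Omega cornerSet) (box n)).ncard ≤ C ^ (n / L + 1) ^ 2) {n : ℕ}
    (hn : 0 < n) :
    patternRate (Omega cornerSet) n ≤ Real.log C * (1 / (L : ℝ) + 1 / (n : ℝ)) ^ 2 := by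
  have hn' : (0 : ℝ) < n := by exact_mod_cast hn
  have hC : 0 ≤ Real.log C := Real.log_natCast_nonneg C
  have h1 : Real.log (patterns (Omega cornerSet) (box n)).ncard ≤
      ((n / L + 1 : ℕ) : ℝ) ^ 2 * Real.log C := by
    have := Real.log_le_log (by exact_mod_cast ncard_patterns_pos n)
      (show ((patterns (Omega cornerSet) (box n)).ncard : ℝ) ≤ (C : ℝ) ^ (n / L + 1) ^ 2 by
        exact_mod_cast h n)
    rw [Real.log_pow] at this
    exact_mod_cast this
  have h2 : ((n / L + 1 : ℕ) : ℝ) ≤ n * (1 / (L : ℝ) + 1 / n) := by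
    have := Nat.cast_div_le (α := ℝ) (m := n) (n := L)
    push_cast
    rw [mul_add, mul_one_div, mul_one_div_cancel hn'.ne']
    linarith
  rw [patternRate, div_le_iff₀ (by positivity)]
  calc _ ≤ ((n / L + 1 : ℕ) : ℝ) ^ 2 * Real.log C := h1
    _ ≤ (n * (1 / (L : ℝ) + 1 / n)) ^ 2 * Real.log C := by gcongr
    _ = _ := by ring

theorem isBoundedUnder_patternRate :
    IsBoundedUnder (· ≤ ·) atTop (patternRate (Omega cornerSet)) := by
  refine isBoundedUnder_of_eventually_le
    (a := Real.log (patterns (Omega cornerSet) (box 1)).ncard * (1 / ((1 : ℕ) : ℝ) + 1) ^ 2) ?_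
  filter_upwards [eventually_gt_atTop 0] with n hn
  refine (patternRate_le (ncard_patterns_le_pow one_pos) hn).trans ?_
  have h1 : (1 : ℝ) / n ≤ 1 := by
    rw [div_le_one (by exact_mod_cast hn)]; exact_mod_cast hn
  have := Real.log_natCast_nonneg (patterns (Omega cornerSet) (box 1)).ncard
  gcongr

theorem entropy_le {L C : ℕ}
    (h : ∀ n, (patterns (Omega cornerSet) (box n)).ncard ≤ C ^ (n / L + 1) ^ 2) :
    entropy (Omega cornerSet) ≤ Real.log C / (L : ℝ) ^ 2 := by
  have ht : Tendsto (fun n : ℕ => Real.log C * (1 / (L : ℝ) + 1 / (n : ℝ)) ^ 2) atTop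
      (𝓝 (Real.log C * (1 / (L : ℝ) + 0) ^ 2)) :=
    ((tendsto_one_div_atTop_nhds_zero_nat.const_add _).pow 2).const_mul _
  have := limsup_le_limsup (f := atTop) (u := patternRate (Omega cornerSet))
    (v := fun n : ℕ => Real.log C * (1 / (L : ℝ) + 1 / (n : ℝ)) ^ 2)
    (by filter_upwards [eventually_gt_atTop 0] with n hn using patternRate_le h hn)
    (isBoundedUnder_of_eventually_ge (a := 0)
      (Eventually.of_forall patternRate_nonneg)).isCoboundedUnder_le ht.isBoundedUnder_le
  rw [ht.limsup_eq] at this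
  refine this.trans_eq ?_
  rw [add_zero, one_div, inv_pow, div_eq_mul_inv]

theorem entropy_le_patternRate {n : ℕ} (hn : 0 < n) :
    entropy (Omega cornerSet) ≤ patternRate (Omega cornerSet) n :=
  entropy_le (ncard_patterns_le_pow hn)

/-- Every pattern rate with `n > 0` bounds the limsup from above, so the limsup is at most the
liminf. -/
theorem tendsto_patternRate :
    Tendsto (patternRate (Omega cornerSet)) atTop (𝓝 (entropy (Omega cornerSet))) := by
  have hb : IsBoundedUnder (· ≥ ·) atTop (patternRate (Omega cornerSet)) :=
    isBoundedUnder_of_eventually_ge (a := 0) (Eventually.of_forall patternRate_nonneg)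
  refine tendsto_of_le_liminf_of_limsup_le ?_ le_rfl isBoundedUnder_patternRate hb
  refine le_liminf_of_le isBoundedUnder_patternRate.isCoboundedUnder_ge ?_
  filter_upwards [eventually_gt_atTop 0] with n hn using entropy_le_patternRate hn

/-! ### Periodic points and entropy -/

theorem card_quotient_Delta (K : ℕ) :
    Nat.card ((ℤ × ℤ) ⧸ Delta K) = 2 * (K ^ 3 + 2 * K) * (2 * K) := index_Delta K

theorem periodicRate_le {K : ℕ} (hK : 0 < K) :
    (1 / (Nat.card ((ℤ × ℤ) ⧸ Delta K) : ℝ)) *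
      Real.log ((fixedBySubgroup (Delta K) (Omega cornerSet)).ncard : ℝ) ≤
      patternRate (Omega cornerSet) (2 * K) := by
  have hK' : (0 : ℝ) < K := by exact_mod_cast hK
  have h1 : Real.log ((fixedBySubgroup (Delta K) (Omega cornerSet)).ncard : ℝ) ≤
      ((K : ℝ) ^ 2 + 2) * Real.log (patterns (Omega cornerSet) (box (2 * K))).ncard := by
    -- As `Real.log 0 = 0`, it is not necessary to know that there are fixed points.
    rcases Nat.eq_zero_or_pos (fixedBySubgroup (Delta K) (Omega cornerSet)).ncard with h | h
    · rw [h, Nat.cast_zero, Real.log_zero]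
      exact mul_nonneg (by positivity) (Real.log_natCast_nonneg _)
    · have := Real.log_le_log (by exact_mod_cast h)
        (show ((fixedBySubgroup (Delta K) (Omega cornerSet)).ncard : ℝ) ≤
          ((patterns (Omega cornerSet) (box (2 * K))).ncard : ℝ) ^ (K ^ 2 + 2) by
          exact_mod_cast (finite_fixedBySubgroup_Delta hK).2)
      rw [Real.log_pow] at this
      exact_mod_cast this
  rw [card_quotient_Delta, patternRate, one_div_mul_eq_div]
  push_cast
  rw [div_le_div_iff₀ (by positivity) (by positivity)]
  calc _ ≤ ((K : ℝ) ^ 2 + 2) * Real.log (patterns (Omega cornerSet) (box (2 * K))).ncard *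
        (2 * K) ^ 2 := by gcongr
    _ = _ := by ring

theorem le_periodicRate_of_dvd {K L n m : ℕ} (hK : 0 < K) (hL : 0 < L)
    (hm : 2 * K = L * m) (hn : 2 * (K ^ 3 + 2 * K) = L * (3 * n)) :
    entropy (Omega cornerSet) - 6 * Real.log 2 / L ≤
      (1 / (Nat.card ((ℤ × ℤ) ⧸ Delta K) : ℝ)) *
      Real.log ((fixedBySubgroup (Delta K) (Omega cornerSet)).ncard : ℝ) := by
  have hL' : (0 : ℝ) < L := by exact_mod_cast hL
  have hm0 : 0 < m := Nat.pos_of_ne_zero (by rintro rfl; omega)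
  have hn0 : 0 < n := Nat.pos_of_ne_zero (by
    rintro rfl
    have : 0 < K ^ 3 := by positivity
    omega)
  obtain ⟨S, hS, hcard⟩ := exists_common_boundary L
  have hfix := pow_le_ncard_fixedBySubgroup hK hL hm hn S hS
  have hP : 0 < Nat.card {p // IsTrianglePattern L p} := by
    refine Nat.pos_of_ne_zero fun h0 => ?_
    -- Even the empty box has one pattern, so the bound cannot be a power of zero.
    have h1 := ncard_patterns_le_trianglePattern_pow hL 0
    rw [h0, zero_pow two_ne_zero, zero_pow (by positivity)] at h1
    have := ncard_patterns_pos 0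
    omega
  have hS0 : 0 < Nat.card S := Nat.pos_of_ne_zero fun h0 => by
    rw [h0, mul_zero] at hcard; omega
  have hS0' : (0 : ℝ) < Nat.card S := by exact_mod_cast hS0
  have h1 : entropy (Omega cornerSet) ≤
      2 * Real.log (Nat.card {p // IsTrianglePattern L p}) / (L : ℝ) ^ 2 := by
    have := entropy_le (ncard_patterns_le_trianglePattern_pow hL)
    rw [Nat.cast_pow, Real.log_pow] at this
    exact_mod_cast this
  have h2 : Real.log (Nat.card {p // IsTrianglePattern L p}) ≤
      3 * L * Real.log 2 + Real.log (Nat.card S) := by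
    have := Real.log_le_log (by exact_mod_cast hP)
      (show (Nat.card {p // IsTrianglePattern L p} : ℝ) ≤ 2 ^ (3 * L) * Nat.card S by
        exact_mod_cast hcard)
    rw [Real.log_mul (by positivity) hS0'.ne', Real.log_pow] at this
    exact_mod_cast this
  have h3 : (3 * n * m * 2) * Real.log (Nat.card S) ≤
      Real.log ((fixedBySubgroup (Delta K) (Omega cornerSet)).ncard : ℝ) := by
    have := Real.log_le_log (by positivity)
      (show (Nat.card S : ℝ) ^ (3 * n * m * 2) ≤
        ((fixedBySubgroup (Delta K) (Omega cornerSet)).ncard : ℝ) by exact_mod_cast hfix)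
    rw [Real.log_pow] at this
    exact_mod_cast this
  rw [card_quotient_Delta, hn, hm]
  push_cast
  have hn0' : (0 : ℝ) < n := by exact_mod_cast hn0
  have hm0' : (0 : ℝ) < m := by exact_mod_cast hm0
  calc _ ≤ 2 * (3 * L * Real.log 2 + Real.log (Nat.card S)) / (L : ℝ) ^ 2 -
        6 * Real.log 2 / L := by
        refine sub_le_sub_right (h1.trans ?_) _
        gcongr
    _ = 1 / (L * (3 * n) * (L * m)) * ((3 * n * m * 2) * Real.log (Nat.card S)) := by
        field_simp
        ring
    _ ≤ _ := by gcongr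

theorem le_periodicRate {K : ℕ} (hK : 0 < K) :
    entropy (Omega cornerSet) - 9 * Real.log 2 / K ≤
      (1 / (Nat.card ((ℤ × ℤ) ⧸ Delta K) : ℝ)) *
      Real.log ((fixedBySubgroup (Delta K) (Omega cornerSet)).ncard : ℝ) := by
  have hK' : (0 : ℝ) < K := by exact_mod_cast hK
  have hlog : 0 < Real.log 2 := Real.log_pos one_lt_two
  -- If `3 ∤ K`, then `3 ∣ K² + 2` and `L = 2K` works. Otherwise `L = 2K/3`, and `6 log 2 / L` is
  -- exactly `9 log 2 / K`.
  by_cases h3 : 3 ∣ K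
  · obtain ⟨j, rfl⟩ := h3
    refine le_trans (le_of_eq ?_) (le_periodicRate_of_dvd (L := 2 * j) (n := 9 * j ^ 2 + 2) (m := 3)
      hK (by omega) (by ring) (by ring))
    have : (j : ℝ) ≠ 0 := by
      have : j ≠ 0 := by omega
      exact_mod_cast this
    push_cast
    field_simp
    ring
  · obtain ⟨n, hn⟩ : 3 ∣ K ^ 2 + 2 := by
      have hmod : K % 3 = 1 ∨ K % 3 = 2 := by omega
      rw [Nat.dvd_iff_mod_eq_zero, Nat.add_mod, Nat.pow_mod]
      rcases hmod with h | h <;> rw [h]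
    refine le_trans ?_ (le_periodicRate_of_dvd (L := 2 * K) (n := n) (m := 1)
      hK (by omega) (by ring) (by rw [← hn]; ring))
    refine sub_le_sub_left ?_ _
    push_cast
    rw [div_le_div_iff₀ (by positivity) (by positivity)]
    nlinarith [mul_pos hlog hK']

theorem tendsto_periodicRate : Tendsto
      (fun K : ℕ =>
        (1 / (Nat.card ((ℤ × ℤ) ⧸ Delta K) : ℝ)) *
          Real.log ((fixedBySubgroup (Delta K)
            (Omega cornerSet)).ncard : ℝ))
      atTop
      (𝓝 (entropy
        (Omega cornerSet))) := by
  have h1 : Tendsto (fun K : ℕ => entropy (Omega cornerSet) - 9 * Real.log 2 / (K : ℝ)) atTop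
      (𝓝 (entropy (Omega cornerSet))) := by
    simpa using (tendsto_const_div_atTop_nhds_zero_nat (9 * Real.log 2)).const_sub
      (entropy (Omega cornerSet))
  have h2 := tendsto_patternRate.comp (tendsto_id.const_mul_atTop' (two_pos (α := ℕ)))
  refine tendsto_of_tendsto_of_tendsto_of_le_of_le' h1 h2 ?_ ?_
  · filter_upwards [eventually_gt_atTop 0] with K hK using le_periodicRate hK
  · filter_upwards [eventually_gt_atTop 0] with K hK using periodicRate_le hK

end RestrictedMovement

theorem proposition6p1 :
    -- Periodic points are dense in `Ω_A` (with the subspace topology).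
    Dense {ω : RestrictedMovement.Omega RestrictedMovement.cornerSet |
      (ω : ℤ × ℤ → RestrictedMovement.cornerSet) ∈
        RestrictedMovement.periodicPoints
          (RestrictedMovement.Omega RestrictedMovement.cornerSet)} ∧
    -- For `K ≥ 1` the group `ℤ²/Δ_K` and the set `Fix_{Δ_K}(Ω_A)` are finite.
    (∀ K : ℕ, 1 ≤ K →
      (RestrictedMovement.Delta K).FiniteIndex ∧
      (RestrictedMovement.fixedBySubgroup (RestrictedMovement.Delta K)
        (RestrictedMovement.Omega RestrictedMovement.cornerSet)).Finite) ∧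
    -- The limit that defines the entropy exists.
    Tendsto
      (RestrictedMovement.patternRate (RestrictedMovement.Omega RestrictedMovement.cornerSet))
      atTop
      (𝓝 (RestrictedMovement.entropy
        (RestrictedMovement.Omega RestrictedMovement.cornerSet))) ∧
    -- The entropy is the logarithmic growth rate of the number of `Δ_K`-periodic points.
    Tendsto
      (fun K : ℕ =>
        (1 / (Nat.card ((ℤ × ℤ) ⧸ RestrictedMovement.Delta K) : ℝ)) *
          Real.log ((RestrictedMovement.fixedBySubgroup (RestrictedMovement.Delta K)
            (RestrictedMovement.Omega RestrictedMovement.cornerSet)).ncard : ℝ))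
      atTop
      (𝓝 (RestrictedMovement.entropy
        (RestrictedMovement.Omega RestrictedMovement.cornerSet))) := by
  exact ⟨RestrictedMovement.dense_periodicPoints,
    fun K hK => ⟨⟨by rw [RestrictedMovement.index_Delta]; positivity⟩,
      (RestrictedMovement.finite_fixedBySubgroup_Delta hK).1⟩,
    RestrictedMovement.tendsto_patternRate, RestrictedMovement.tendsto_periodicRate⟩
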